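/- Let $n\ge 2$ and let $K_n$ be the complete graph on the vertex set $[n]=\{1,\dots,n\}$, with Laplacian $\Delta\colon\mathbb Z^n\to\mathbb Z^n$. Call $\mathbf d,\mathbf d'\in\mathbb Z^n$ equivalent, written $\mathbf d\sim\mathbf d'$, if $\mathbf d-\mathbf d'\in\mathrm{Image}(\Delta)$; let $\mathcal N\subset\mathbb Z^n$ be the set of elements that are not equivalent to any element with all components nonnegative, and let $$r_{\rm BN}(\mathbf d)=-1+\min_{\mathbf d'\in\mathcal N}\sum_{i=1}^n|d_i-d'_i|$$ be the Baker–Norine rank of $K_n$. Let $W=\mathfrak m(r_{\rm BN})\colon\mathbb Z^n\to\mathbb Z$ be its weight, $$W(\mathbf d)=\sum_{I\subset[n]}(-1)^{|I|}\,r_{\rm BN}(\mathbf d-\mathbf e_I),\qquad \mathbf e_I=\sum_{i\in I}\mathbf e_i,$$ where $\mathbf e_1,\dots,\mathbf e_n$ is the standard basis. Put $\mathcal B=\{0,\dots,n-1\}^{n-2}$ and, for $\mathbf b\in\mathcal B$ and $i\in\mathbb Z$, $$\langle\mathbf b,i\rangle=\bigl(b_1,\dots,b_{n-2},\,0,\,i-b_1-\cdots-b_{n-2}\bigr)\in\mathbb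 Z^n .$$ Then $W$ is constant on equivalence classes, every $\mathbf d\in\mathbb Z^n$ is equivalent to $\langle\mathbf b,i\rangle$ for exactly one pair $(\mathbf b,i)\in\mathcal B\times\mathbb Z$, and for all $\mathbf b\in\mathcal B$ and $i\in\mathbb Z$ $$W(\langle\mathbf b,i\rangle)=\begin{cases}(-1)^\ell\binom{n-2}{\ell}&\text{if }\mathbf b=\mathbf 0\text{ and } i=n\ell\text{ for some }\ell\in\{0,\dots,n-2\},\\ 0&\text{otherwise.}\end{cases}$$ -/

import Mathlib

open scoped Matrix

namespace BakerNorine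

/-- The degree `d₁ + ⋯ + dₙ` of `d ∈ ℤⁿ`. -/
def deg {n : ℕ} (d : Fin n → ℤ) : ℤ := ∑ i, d i

/-- The usual `L¹`-norm `|x₁| + ⋯ + |xₙ|` on `ℤⁿ`, as a natural number. -/
def l1Norm {n : ℕ} (x : Fin n → ℤ) : ℕ := ∑ i, (x i).natAbs

/-- `d ∼ d'`: the difference lies in the image of the Laplacian `ℤⁿ → ℤⁿ` of `G`. -/
def Equivalent {n : ℕ} (G : SimpleGraph (Fin n)) [DecidableRel G.Adj] (d d' : Fin n → ℤ) : Prop :=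
  ∃ x : Fin n → ℤ, G.lapMatrix ℤ *ᵥ x = d - d'

/-- The elements of `ℤⁿ` that are not equivalent to an effective (componentwise nonnegative)
element. -/
def nonEffective {n : ℕ} (G : SimpleGraph (Fin n)) [DecidableRel G.Adj] : Set (Fin n → ℤ) :=
  {d | ¬ ∃ d' : Fin n → ℤ, 0 ≤ d' ∧ Equivalent G d d'}

/-- The `L¹`-distance `min {‖d - d'‖ : d' ∈ 𝒩}` from `d` to the set `𝒩` of elements that are not
equivalent to an effective one. The set of distances is a set of natural numbers, nonempty for
`n ≥ 1` (see `exists_l1Norm_eq_rankPlusOne`), so that its infimum is its minimum. -/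
noncomputable def rankPlusOne {n : ℕ} (G : SimpleGraph (Fin n)) [DecidableRel G.Adj]
    (d : Fin n → ℤ) : ℕ :=
  sInf {k : ℕ | ∃ d' ∈ nonEffective G, l1Norm (d - d') = k}

/-- The Baker–Norine rank of `d ∈ ℤⁿ`. -/
noncomputable def rank {n : ℕ} (G : SimpleGraph (Fin n)) [DecidableRel G.Adj]
    (d : Fin n → ℤ) : ℤ :=
  (rankPlusOne G d : ℤ) - 1

/-- `e_I`, the sum of the standard basis vectors `e_i` with `i ∈ I`. -/
def eSum {n : ℕ} (I : Finset (Fin n)) : Fin n → ℤ := ∑ i ∈ I, Pi.single i 1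

/-- The operator `(𝔪 f)(d) = ∑_{I ⊆ [n]} (-1)^{|I|} f(d - e_I)`. -/
def moebius {n : ℕ} (f : (Fin n → ℤ) → ℤ) (d : Fin n → ℤ) : ℤ :=
  ∑ I : Finset (Fin n), (-1) ^ I.card * f (d - eSum I)

/-- The weight `W = 𝔪 r` of the Baker–Norine rank `r` of the complete graph `Kₙ`. -/
noncomputable def weightComplete (n : ℕ) : (Fin n → ℤ) → ℤ :=
  moebius (rank (⊤ : SimpleGraph (Fin n)))

/-- `ℬ = {0, …, n-1}^{n-2}`. -/
def coordSet (n : ℕ) : Set (Fin (n - 2) → ℤ) :=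
  {b | ∀ j, 0 ≤ b j ∧ b j ≤ (n : ℤ) - 1}

/-- `⟨b, i⟩ = (b₁, …, b_{n-2}, 0, i - b₁ - ⋯ - b_{n-2}) ∈ ℤⁿ` (for `n ≥ 2`). -/
def coord {n : ℕ} (b : Fin (n - 2) → ℤ) (i : ℤ) : Fin n → ℤ := fun k =>
  if h : (k : ℕ) < n - 2 then b ⟨k, h⟩
  else if (k : ℕ) = n - 2 then 0
  else i - ∑ j, b j

section sanity

variable {n : ℕ} (G : SimpleGraph (Fin n)) [DecidableRel G.Adj]

theorem deg_lapMatrix_mulVec (x : Fin n → ℤ) : deg (G.lapMatrix ℤ *ᵥ x) = 0 := by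
  have h1 : deg (G.lapMatrix ℤ *ᵥ x) = (fun _ => (1 : ℤ)) ⬝ᵥ (G.lapMatrix ℤ *ᵥ x) := by
    simp [deg, dotProduct]
  rw [h1, Matrix.dotProduct_mulVec, ← Matrix.mulVec_transpose,
    (G.isSymm_lapMatrix (R := ℤ)).eq, G.lapMatrix_mulVec_const_eq_zero]
  simp

/-- Every element of negative degree is not equivalent to an effective one. -/
theorem mem_nonEffective_of_deg_neg {d : Fin n → ℤ} (hd : deg d < 0) : d ∈ nonEffective G := by
  rintro ⟨d', hd', x, hx⟩
  have h := deg_lapMatrix_mulVec G x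
  have h0 : 0 ≤ deg d' := Finset.sum_nonneg fun i _ => hd' i
  have h2 : deg (d - d') = deg d - deg d' := by simp [deg]
  rw [hx, h2] at h
  linarith

/-- The minimum in the definition of `rankPlusOne` is attained. -/
theorem exists_l1Norm_eq_rankPlusOne (hn : 1 ≤ n) (d : Fin n → ℤ) :
    ∃ d' ∈ nonEffective G, l1Norm (d - d') = rankPlusOne G d := by
  refine Nat.sInf_mem (s := {k : ℕ | ∃ d' ∈ nonEffective G, l1Norm (d - d') = k})
    ⟨_, fun _ => -1, mem_nonEffective_of_deg_neg G ?_, rfl⟩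
  simp only [deg, Finset.sum_const, Finset.card_univ, Fintype.card_fin, nsmul_eq_mul]
  have : (1 : ℤ) ≤ n := by exact_mod_cast hn
  linarith

/-- The Baker–Norine rank is initially equal to `-1`. -/
theorem rank_of_deg_neg {d : Fin n → ℤ} (hd : deg d < 0) : rank G d = -1 := by
  have h : rankPlusOne G d = 0 :=
    Nat.sInf_eq_zero.2 (Or.inl ⟨d, mem_nonEffective_of_deg_neg G hd, by simp [l1Norm]⟩)
  simp [rank, h]

end sanity

end BakerNorine

/-!
The Laplacian of `Kₙ` sends `x` to `n x - (∑ x) 1`, so two elements are equivalent exactly when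
they have the same degree and their entries differ, modulo `n`, by a common constant. This gives
the normal form `⟨b, i⟩` of a class.

The rank is computed through the slacks `F(d, c) = 1 - c + ∑ᵢ ⌊(dᵢ + c) / n⌋`, which are periodic
in `c` with period `n`. An element `d` is equivalent to an effective one if and only if
`F(d, c) ≥ 1` for some `c` (`notMem_nonEffective_iff`), and

  `r(d) + 1 = ∑_{0 ≤ c < n} max(0, F(d, c))`   (`rank_top_eq`).

Indeed, let `N(d)` be the right-hand side. It vanishes exactly on the non-effective elements.
Replacing `d` by `d - eⱼ` lowers only the slack at `c ≡ -dⱼ`, and that one by `1`, so `N` is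
`1`-Lipschitz for the `L¹`-norm; this bounds the distance to the non-effective elements from
below. If `N(d) > 0`, then `F(d, -dⱼ) ≥ 1` for some `j` (`exists_slack_neg_pos`), and removing a
chip at `j` lowers `N`; repeating this reaches a non-effective element after `N(d)` steps.

Since `F(d - e_I, c) = F(d, c) - #{i ∈ I : n ∣ dᵢ + c}`, the alternating sum over `I` of the
`c`-th summand vanishes unless `n` divides every `dᵢ + c`. For `d = ⟨b, i⟩`, which has an entry
`0`, this forces `c = 0`, `b = 0` and `n ∣ i`. In that case `F(d, 0) = i / n + 1`, and the sum is
the `n`-th backward difference of `max(0, ·)` at this point. Two of the differences turn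
`max(0, ·)` into the indicator function of `1`, and the other `n - 2` give
`(-1)^ℓ (n-2 choose ℓ)` at `i = nℓ` (`sum_choose_mul_max`).
-/

namespace BakerNorine

open Finset

/-! ### Linear equivalence on the complete graph -/

theorem lapMatrix_top_mulVec_apply {n : ℕ} (x : Fin n → ℤ) (i : Fin n) :
    ((⊤ : SimpleGraph (Fin n)).lapMatrix ℤ *ᵥ x) i = n * x i - ∑ j, x j := by
  have hn : 1 ≤ n := i.pos
  rw [SimpleGraph.lapMatrix_mulVec_apply, SimpleGraph.complete_graph_degree,
    SimpleGraph.neighborFinset_eq_filter]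
  have h : (univ.filter fun w => (⊤ : SimpleGraph (Fin n)).Adj i w) = univ.erase i := by
    ext w; simp [eq_comm]
  rw [h, ← add_sum_erase _ _ (mem_univ i), Fintype.card_fin]
  push_cast [hn]
  ring

theorem deg_sub {n : ℕ} (d d' : Fin n → ℤ) : deg (d - d') = deg d - deg d' := by
  simp [deg]

theorem Equivalent.deg_eq {n : ℕ} {G : SimpleGraph (Fin n)} [DecidableRel G.Adj]
    {d d' : Fin n → ℤ} (h : Equivalent G d d') : deg d = deg d' := by
  obtain ⟨x, hx⟩ := h
  have := deg_lapMatrix_mulVec G x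
  rw [hx, deg_sub] at this
  linarith

theorem Equivalent.symm {n : ℕ} {G : SimpleGraph (Fin n)} [DecidableRel G.Adj]
    {d d' : Fin n → ℤ} (h : Equivalent G d d') : Equivalent G d' d := by
  obtain ⟨x, hx⟩ := h
  exact ⟨-x, by rw [Matrix.mulVec_neg, hx]; simp⟩

theorem Equivalent.trans {n : ℕ} {G : SimpleGraph (Fin n)} [DecidableRel G.Adj]
    {d d' d'' : Fin n → ℤ} (h : Equivalent G d d') (h' : Equivalent G d' d'') :
    Equivalent G d d'' := by
  obtain ⟨x, hx⟩ := h
  obtain ⟨y, hy⟩ := h'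
  exact ⟨x + y, by rw [Matrix.mulVec_add, hx, hy]; simp⟩

theorem Equivalent.sub_right {n : ℕ} {G : SimpleGraph (Fin n)} [DecidableRel G.Adj]
    {d d' : Fin n → ℤ} (h : Equivalent G d d') (e : Fin n → ℤ) :
    Equivalent G (d - e) (d' - e) := by
  obtain ⟨x, hx⟩ := h
  exact ⟨x, by rw [hx]; simp⟩

theorem Equivalent.exists_dvd {n : ℕ} {d d' : Fin n → ℤ}
    (h : Equivalent (⊤ : SimpleGraph (Fin n)) d d') :
    ∃ s : ℤ, ∀ i, (n : ℤ) ∣ d i - d' i - s := by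
  obtain ⟨x, hx⟩ := h
  refine ⟨-∑ j, x j, fun i => ⟨x i, ?_⟩⟩
  have := congrFun hx i
  rw [lapMatrix_top_mulVec_apply, Pi.sub_apply] at this
  linarith

/-- The congruence need not be assumed at one vertex `k`: it follows there from the equality of
degrees. -/
theorem equivalent_top_of_deg_eq {n : ℕ} {d d' : Fin n → ℤ} (hdeg : deg d = deg d') (k : Fin n)
    (s : ℤ) (h : ∀ i, i ≠ k → (n : ℤ) ∣ d i - d' i - s) :
    Equivalent (⊤ : SimpleGraph (Fin n)) d d' := by
  choose! y hy using h
  -- The value at `k` is chosen so that `∑ x = -s`.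
  set x : Fin n → ℤ := Function.update y k (-s - ∑ j ∈ univ.erase k, y j) with hxdef
  have hxne : ∀ i, i ≠ k → x i = y i := fun i hi => by simp [hxdef, hi]
  have hsum : ∑ j, x j = -s := by
    rw [← add_sum_erase _ _ (mem_univ k),
      sum_congr rfl fun j hj => hxne j (ne_of_mem_erase hj)]
    simp [hxdef]
  have hne : ∀ i, i ≠ k → ((⊤ : SimpleGraph (Fin n)).lapMatrix ℤ *ᵥ x) i = (d - d') i := by
    intro i hi
    rw [lapMatrix_top_mulVec_apply, hsum, hxne i hi, ← hy i hi, Pi.sub_apply]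
    ring
  -- Both sides have degree `0` and agree away from `k`, hence agree at `k`.
  have h1 := deg_lapMatrix_mulVec (⊤ : SimpleGraph (Fin n)) x
  have h2 : deg (d - d') = 0 := by rw [deg_sub, hdeg, sub_self]
  refine ⟨x, funext fun i => ?_⟩
  by_cases hi : i = k
  · subst hi
    rw [deg, ← add_sum_erase _ _ (mem_univ i)] at h1 h2
    rw [sum_congr rfl fun j hj => hne j (ne_of_mem_erase hj)] at h1
    linarith
  · exact hne i hi

/-! ### Invariance of the weight -/

theorem rank_eq_of_equivalent {n : ℕ} {G : SimpleGraph (Fin n)} [DecidableRel G.Adj]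
    {d d' : Fin n → ℤ} (h : Equivalent G d d') : rank G d = rank G d' := by
  have key : ∀ {d d' : Fin n → ℤ}, Equivalent G d d' → ∀ k,
      (∃ e ∈ nonEffective G, l1Norm (d - e) = k) → ∃ e ∈ nonEffective G, l1Norm (d' - e) = k := by
    rintro d d' h k ⟨e, he, hk⟩
    -- Translate `e` along with `d`, so that the difference is unchanged.
    refine ⟨d' - (d - e), ?_, by simpa using hk⟩
    rintro ⟨f, hf, hef⟩
    refine he ⟨f, hf, Equivalent.trans ?_ hef⟩
    simpa using h.sub_right (d - e)
  unfold rank rankPlusOne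
  congr 3
  exact Set.ext fun k => ⟨key h k, key h.symm k⟩

theorem weightComplete_eq_of_equivalent {n : ℕ} {d d' : Fin n → ℤ}
    (h : Equivalent (⊤ : SimpleGraph (Fin n)) d d') :
    weightComplete n d = weightComplete n d' := by
  unfold weightComplete moebius
  exact sum_congr rfl fun I _ => by rw [rank_eq_of_equivalent (h.sub_right _)]

/-! ### The slack function -/

/-- The slack `1 - c + ∑ᵢ ⌊(dᵢ + c) / n⌋`. Adding `c` to every entry of `d` and reducing all
entries modulo `n` leaves `slack d c - 1` multiples of `n`, counted with sign, to be put back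
in order to obtain an element equivalent to `d`. -/
def slack {n : ℕ} (d : Fin n → ℤ) (c : ℤ) : ℤ := 1 - c + ∑ i, (d i + c) / (n : ℤ)

theorem sub_one_ediv {n : ℤ} (hn : 0 < n) (a : ℤ) :
    (a - 1) / n = a / n - if n ∣ a then 1 else 0 := by
  have h1 := Int.emod_add_mul_ediv a n
  have h2 := Int.emod_nonneg a hn.ne'
  have h3 := Int.emod_lt_of_pos a hn
  split_ifs with h
  · have h4 := Int.emod_eq_zero_of_dvd h
    rw [Int.ediv_eq_iff_of_pos hn]
    constructor <;> nlinarith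
  · have h4 : a % n ≠ 0 := fun h' => h (Int.dvd_of_emod_eq_zero h')
    have h5 : 1 ≤ a % n := by omega
    rw [Int.ediv_eq_iff_of_pos hn]
    constructor <;> nlinarith

theorem slack_eq_of_dvd {n : ℕ} (hn : 0 < n) (d : Fin n → ℤ) {c c' : ℤ}
    (h : (n : ℤ) ∣ c - c') : slack d c = slack d c' := by
  obtain ⟨k, hk⟩ := h
  have hn' : (n : ℤ) ≠ 0 := by exact_mod_cast hn.ne'
  have : ∀ i, (d i + c) / (n : ℤ) = (d i + c') / (n : ℤ) + k := fun i => by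
    rw [← Int.add_mul_ediv_left _ _ hn']
    congr 1
    linarith
  simp only [slack, this, sum_add_distrib, sum_const, card_univ, Fintype.card_fin, nsmul_eq_mul]
  linarith

theorem eSum_apply {n : ℕ} (I : Finset (Fin n)) (i : Fin n) :
    eSum I i = if i ∈ I then 1 else 0 := by
  simp [eSum, Finset.sum_apply, Pi.single_apply]

theorem slack_sub_eSum {n : ℕ} (d : Fin n → ℤ) (I : Finset (Fin n)) (c : ℤ) :
    slack (d - eSum I) c = slack d c - #{i ∈ I | (n : ℤ) ∣ d i + c} := by
  have : ∀ i, ((d - eSum I) i + c) / (n : ℤ) =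
      (d i + c) / (n : ℤ) - if i ∈ I ∧ (n : ℤ) ∣ d i + c then 1 else 0 := fun i => by
    have hn : (0 : ℤ) < n := by exact_mod_cast i.pos
    rw [Pi.sub_apply, eSum_apply]
    by_cases hi : i ∈ I
    · simp only [hi, if_true, true_and]
      rw [← sub_one_ediv hn]
      congr 1
      ring
    · simp [hi]
  simp only [slack, this, sum_sub_distrib]
  have h2 : (univ.filter fun i => i ∈ I ∧ (n : ℤ) ∣ d i + c) = {i ∈ I | (n : ℤ) ∣ d i + c} := by
    ext; simp
  rw [sum_boole, h2]
  ring

theorem slack_pred {n : ℕ} (d : Fin n → ℤ) (c : ℤ) (h : ∀ i, ¬ (n : ℤ) ∣ d i + c) :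
    slack d (c - 1) = slack d c + 1 := by
  have : ∀ i, (d i + (c - 1)) / (n : ℤ) = (d i + c) / (n : ℤ) := fun i => by
    have hn : (0 : ℤ) < n := by exact_mod_cast i.pos
    rw [← add_sub_assoc, sub_one_ediv hn, if_neg (h i), sub_zero]
  simp only [slack, this]
  ring

/-- If some slack is positive, then so is one at an argument `-d j`: going down from `c`, the
slack increases by one at each step until some `d i + c` is divisible by `n`. -/
theorem exists_slack_neg_pos {n : ℕ} (hn : 0 < n) (d : Fin n → ℤ) {c : ℤ} (hc : 1 ≤ slack d c) :
    ∃ j, 1 ≤ slack d (-d j) := by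
  have hn' : (0 : ℤ) < n := by exact_mod_cast hn
  -- Some entry satisfies `n ∣ d i + (c - k)` for the `k` below, so the descent stops in time.
  suffices H : ∀ (k : ℕ) (c : ℤ), (n : ℤ) ∣ d ⟨0, hn⟩ + c - k → 1 ≤ slack d c →
      ∃ j, 1 ≤ slack d (-d j) by
    refine H ((d ⟨0, hn⟩ + c) % n).toNat c ?_ hc
    rw [Int.toNat_of_nonneg (Int.emod_nonneg _ hn'.ne')]
    exact Int.dvd_self_sub_emod
  intro k
  induction k with
  | zero =>
    intro c h hc
    exact ⟨⟨0, hn⟩, hc.trans (slack_eq_of_dvd hn d (by simpa [add_comm] using h)).le⟩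
  | succ k ih =>
    intro c h hc
    by_cases hi : ∃ i, (n : ℤ) ∣ d i + c
    · obtain ⟨i, hi⟩ := hi
      exact ⟨i, hc.trans (slack_eq_of_dvd hn d (by simpa [add_comm] using hi)).le⟩
    · push Not at hi
      refine ih (c - 1) ?_ (by rw [slack_pred d c hi]; linarith)
      convert h using 1
      push_cast
      ring

/-- `d` is equivalent to an effective element exactly when one of its slacks is positive. -/
theorem notMem_nonEffective_iff {n : ℕ} (hn : 0 < n) (d : Fin n → ℤ) :
    d ∉ nonEffective (⊤ : SimpleGraph (Fin n)) ↔ ∃ c, 1 ≤ slack d c := by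
  have hn' : (0 : ℤ) < n := by exact_mod_cast hn
  simp only [nonEffective, Set.mem_ofPred_eq, not_not]
  constructor
  · rintro ⟨d', hd', x, hx⟩
    refine ⟨∑ j, x j, ?_⟩
    have h : ∀ i, x i ≤ (d i + ∑ j, x j) / (n : ℤ) := fun i => by
      have h1 := congrFun hx i
      have h2 : 0 ≤ d' i := hd' i
      rw [lapMatrix_top_mulVec_apply, Pi.sub_apply] at h1
      rw [Int.le_ediv_iff_mul_le hn']
      linarith
    have := sum_le_sum fun i (_ : i ∈ univ) => h i
    unfold slack
    linarith
  · rintro ⟨c, hc⟩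
    set k : Fin n := ⟨0, hn⟩
    -- All entries of `d + c` are reduced modulo `n`; what remains is put at the vertex `k`.
    refine ⟨Function.update (fun i => (d i + c) % n) k
      ((d k + c) % n + n * (slack d c - 1)), ?_, equivalent_top_of_deg_eq ?_ k (-c) ?_⟩
    · intro i
      by_cases hi : i = k
      · subst hi
        have h1 := Int.emod_nonneg (d k + c) hn'.ne'
        simp only [Pi.zero_apply, Function.update_self]
        have : 0 ≤ (n : ℤ) * (slack d c - 1) := mul_nonneg hn'.le (by linarith)
        linarith
      · simpa [hi] using Int.emod_nonneg (d i + c) hn'.ne'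
    · have h1 : ∀ i, (d i + c) % (n : ℤ) = d i + c - n * ((d i + c) / n) := fun i =>
        Int.emod_def _ _
      have h2 : ∑ i, (d i + c) % (n : ℤ) = deg d + n * c - n * ∑ i, (d i + c) / (n : ℤ) := by
        simp [h1, sum_sub_distrib, sum_add_distrib, deg, mul_sum]
      unfold deg
      rw [sum_update_of_mem (mem_univ k), ← erase_eq, add_right_comm,
        add_sum_erase univ (fun i => (d i + c) % (n : ℤ)) (mem_univ k), h2]
      unfold slack deg
      ring
    · intro i hi
      rw [Function.update_of_ne hi]
      have := Int.dvd_self_sub_emod (x := d i + c) (m := (n : ℤ))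
      convert this using 1
      ring

/-! ### The rank as a sum of positive parts of slacks -/

/-- The sum of the positive parts of the slacks over one period. -/
noncomputable def slackSum {n : ℕ} (d : Fin n → ℤ) : ℤ := ∑ c ∈ Ico (0 : ℤ) n, max 0 (slack d c)

theorem slackSum_nonneg {n : ℕ} (d : Fin n → ℤ) : 0 ≤ slackSum d :=
  sum_nonneg fun _ _ => le_max_left _ _

theorem slackSum_eq_zero_iff {n : ℕ} (hn : 0 < n) (d : Fin n → ℤ) :
    slackSum d = 0 ↔ d ∈ nonEffective (⊤ : SimpleGraph (Fin n)) := by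
  have hn' : (0 : ℤ) < n := by exact_mod_cast hn
  rw [← not_iff_not, notMem_nonEffective_iff hn, slackSum,
    sum_eq_zero_iff_of_nonneg fun _ _ => le_max_left _ _]
  push Not
  constructor
  · rintro ⟨c, -, hc⟩
    refine ⟨c, ?_⟩
    by_contra h
    exact hc (max_eq_left (by omega))
  · rintro ⟨c, hc⟩
    refine ⟨c % n, ?_, ?_⟩
    · simp [Int.emod_nonneg c hn'.ne', Int.emod_lt_of_pos c hn']
    · rw [slack_eq_of_dvd hn d (c' := c) (by
        rw [← dvd_neg, neg_sub]; exact Int.dvd_self_sub_emod)]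
      rw [max_eq_right (by omega)]
      omega

/-- Removing a chip at `j` affects only the slack at `c ≡ -d j` modulo `n`. -/
theorem slackSum_sub_single {n : ℕ} (d : Fin n → ℤ) (j : Fin n) :
    slackSum (d - Pi.single j 1) = slackSum d - if 1 ≤ slack d (-d j) then 1 else 0 := by
  have hn : 0 < n := j.pos
  have hn' : (0 : ℤ) < n := by exact_mod_cast hn
  have hs : (Pi.single j 1 : Fin n → ℤ) = eSum {j} := by simp [eSum]
  have hmem : (-d j) % (n : ℤ) ∈ Ico (0 : ℤ) n := by
    simp [Int.emod_nonneg (-d j) hn'.ne', Int.emod_lt_of_pos (-d j) hn']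
  have hdvd : (n : ℤ) ∣ (-d j) % (n : ℤ) - -d j := by
    rw [← dvd_neg, neg_sub]; exact Int.dvd_self_sub_emod
  suffices slackSum d - slackSum (d - Pi.single j 1) = if 1 ≤ slack d (-d j) then 1 else 0 by
    linarith
  rw [hs, slackSum, slackSum, ← sum_sub_distrib, sum_eq_single_of_mem _ hmem]
  · have h1 : ({i ∈ ({j} : Finset (Fin n)) | (n : ℤ) ∣ d i + (-d j) % (n : ℤ)}) = {j} := by
      rw [filter_eq_self]
      simpa [add_comm] using hdvd
    rw [slack_sub_eSum, h1, slack_eq_of_dvd hn d hdvd, card_singleton]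
    split_ifs <;> push_cast <;> omega
  · intro c hc hne
    have h1 : ({i ∈ ({j} : Finset (Fin n)) | (n : ℤ) ∣ d i + c}) = ∅ := by
      rw [filter_eq_empty_iff]
      intro i hi hdvd'
      rw [mem_singleton] at hi
      subst hi
      apply hne
      rw [mem_Ico] at hc
      rw [← Int.emod_eq_of_lt hc.1 hc.2]
      exact Int.emod_eq_emod_iff_emod_sub_eq_zero.2
        (Int.emod_eq_zero_of_dvd (by simpa [add_comm] using hdvd'))
    simp [slack_sub_eSum, h1]

/-- The function `slackSum` is `1`-Lipschitz, by induction on the distance, moving one chip at a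
time. -/
theorem slackSum_le_add_l1Norm {n : ℕ} (d d' : Fin n → ℤ) :
    slackSum d ≤ slackSum d' + l1Norm (d - d') := by
  obtain ⟨k, hk⟩ : ∃ k, l1Norm (d - d') = k := ⟨_, rfl⟩
  induction k generalizing d with
  | zero =>
    have : d = d' := by
      funext i
      have h1 : ((d - d') i).natAbs = 0 := (sum_eq_zero_iff.1 hk) i (mem_univ i)
      rw [Pi.sub_apply] at h1
      omega
    subst this
    simp
  | succ k ih =>
    obtain ⟨j, -, hj⟩ : ∃ j ∈ univ, ((d - d') j).natAbs ≠ 0 :=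
      exists_ne_zero_of_sum_ne_zero (by rw [l1Norm] at hk; omega)
    rw [Pi.sub_apply] at hj
    have hstep : ∀ e : Fin n → ℤ, (∀ i, i ≠ j → e i = d i) →
        ((e j - d' j).natAbs + 1 = (d j - d' j).natAbs) → l1Norm (e - d') = k := by
      intro e he hej
      unfold l1Norm at hk ⊢
      rw [← add_sum_erase _ _ (mem_univ j)] at hk ⊢
      rw [sum_congr rfl fun i hi => show ((e - d') i).natAbs = ((d - d') i).natAbs by
        rw [Pi.sub_apply, Pi.sub_apply, he i (ne_of_mem_erase hi)]]
      rw [Pi.sub_apply] at hk ⊢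
      omega
    rw [hk]
    push_cast
    rcases lt_or_gt_of_ne (show d j ≠ d' j by omega) with hlt | hgt
    · have h1 := hstep (d + Pi.single j 1) (fun i hi => by simp [hi]) (by simp; omega)
      have h2 := ih _ h1
      have h3 := slackSum_sub_single (d + Pi.single j 1) j
      rw [add_sub_cancel_right] at h3
      rw [h1] at h2
      split_ifs at h3 <;> linarith
    · have h1 := hstep (d - Pi.single j 1) (fun i hi => by simp [hi]) (by simp; omega)
      have h2 := ih _ h1
      have h3 := slackSum_sub_single d j
      rw [h1] at h2
      split_ifs at h3 <;> linarith

/-- Chips can be removed one at a time, each lowering `slackSum` by one, until a non-effective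
element is reached. -/
theorem exists_l1Norm_le_slackSum {n : ℕ} (hn : 0 < n) (d : Fin n → ℤ) :
    ∃ d' ∈ nonEffective (⊤ : SimpleGraph (Fin n)), (l1Norm (d - d') : ℤ) ≤ slackSum d := by
  obtain ⟨k, hk⟩ : ∃ k : ℕ, slackSum d = k := ⟨_, (Int.toNat_of_nonneg (slackSum_nonneg d)).symm⟩
  induction k generalizing d with
  | zero => exact ⟨d, (slackSum_eq_zero_iff hn d).1 (by simpa using hk), by simp [l1Norm, hk]⟩
  | succ k ih =>
    obtain ⟨c, hc⟩ := (notMem_nonEffective_iff hn d).1 fun h => by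
      rw [← slackSum_eq_zero_iff hn] at h
      push_cast at hk
      omega
    obtain ⟨j, hj⟩ := exists_slack_neg_pos hn d hc
    have h1 := slackSum_sub_single d j
    rw [if_pos hj] at h1
    push_cast at hk
    obtain ⟨d', hd', hle⟩ := ih (d - Pi.single j 1) (by linarith)
    refine ⟨d', hd', ?_⟩
    have htri : l1Norm (d - d') ≤ l1Norm (d - Pi.single j 1 - d') + 1 := by
      have : l1Norm (Pi.single j 1 : Fin n → ℤ) = 1 := by
        unfold l1Norm
        rw [sum_eq_single j (fun i _ hi => by simp [hi]) (by simp)]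
        simp
      rw [← this]
      unfold l1Norm
      rw [← sum_add_distrib]
      refine sum_le_sum fun i _ => ?_
      have : (d - d') i =
          (d - (Pi.single j 1 : Fin n → ℤ) - d') i + (Pi.single j 1 : Fin n → ℤ) i := by
        simp only [Pi.sub_apply]; ring
      rw [this]
      exact Int.natAbs_add_le _ _
    have : (l1Norm (d - d') : ℤ) ≤ l1Norm (d - Pi.single j 1 - d') + 1 := by exact_mod_cast htri
    linarith

/-- The rank formula `r(d) + 1 = ∑_c max(0, slack d c)` for the complete graph. -/
theorem rank_top_eq {n : ℕ} (hn : 0 < n) (d : Fin n → ℤ) :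
    rank (⊤ : SimpleGraph (Fin n)) d = slackSum d - 1 := by
  unfold rank
  congr 1
  apply le_antisymm
  · obtain ⟨d', hd', hle⟩ := exists_l1Norm_le_slackSum hn d
    refine le_trans ?_ hle
    exact Int.ofNat_le.2 (Nat.sInf_le ⟨d', hd', rfl⟩)
  · obtain ⟨d', hd', hk⟩ := exists_l1Norm_eq_rankPlusOne (⊤ : SimpleGraph (Fin n)) hn d
    have := slackSum_le_add_l1Norm d d'
    rwa [(slackSum_eq_zero_iff hn d').2 hd', zero_add, hk] at this

/-! ### Alternating sums over subsets -/

/-- An alternating sum over subsets vanishes if the summand ignores some element `j`. -/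
theorem sum_neg_one_pow_card_mul_eq_zero {α : Type*} [Fintype α] [DecidableEq α] (j : α)
    (f : Finset α → ℤ) (hf : ∀ I, j ∉ I → f (insert j I) = f I) :
    ∑ I : Finset α, (-1) ^ #I * f I = 0 := by
  rw [← powerset_univ, ← insert_erase (mem_univ j),
    sum_powerset_insert (notMem_erase j univ), ← sum_add_distrib]
  refine sum_eq_zero fun I hI => ?_
  have hj : j ∉ I := fun h => notMem_erase j univ (mem_powerset.1 hI h)
  rw [hf I hj, card_insert_of_notMem hj]
  ring

theorem fwdDiff_neg_one_max_iter_two (a : ℤ) :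
    (fwdDiff (-1 : ℤ))^[2] (fun m : ℤ => max 0 m) a = if a = 1 then 1 else 0 := by
  simp only [Function.iterate_succ, Function.iterate_zero, Function.comp_apply, id, fwdDiff]
  split_ifs <;> omega

/-- Two of the `n` differences turn `max 0` into the indicator function of `1`; the others
produce the signed binomial coefficients. -/
theorem sum_choose_mul_max (n : ℕ) (a : ℤ) :
    ∑ k ∈ range (n + 2 + 1), ((n + 2).choose k : ℤ) * ((-1) ^ k * max 0 (a - k)) =
      ∑ k ∈ range (n + 1), if a = k + 1 then (-1) ^ k * (n.choose k : ℤ) else 0 := by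
  have hsign : ∀ {N k : ℕ}, k ∈ range (N + 1) → (-1 : ℤ) ^ k = (-1) ^ N * (-1) ^ (N - k) := by
    intro N k hk
    rw [mem_range] at hk
    obtain ⟨t, rfl⟩ := Nat.exists_eq_add_of_le (show k ≤ N by omega)
    rw [Nat.add_sub_cancel_left, pow_add, mul_assoc, ← mul_pow]
    simp
  have h1 := fwdDiff_iter_eq_sum_shift (-1 : ℤ) (fun m : ℤ => max 0 m) (n + 2) a
  have h2 : (fwdDiff (-1 : ℤ))^[2] (fun m : ℤ => max 0 m) = fun a => if a = 1 then 1 else 0 :=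
    funext fwdDiff_neg_one_max_iter_two
  rw [Function.iterate_add_apply, h2, fwdDiff_iter_eq_sum_shift] at h1
  have h3 := congrArg (fun z => (-1 : ℤ) ^ n * z) h1
  simp only [mul_sum] at h3
  refine Eq.trans ?_ (h3.symm.trans ?_)
  · refine sum_congr rfl fun k hk => ?_
    rw [hsign hk]
    simp only [nsmul_eq_mul, smul_eq_mul, mul_neg, mul_one, ← sub_eq_add_neg, pow_add]
    ring
  · refine sum_congr rfl fun k hk => ?_
    have : a + k • (-1 : ℤ) = 1 ↔ a = k + 1 := by
      simp only [nsmul_eq_mul, mul_neg, mul_one]; omega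
    simp only [this, hsign hk, smul_eq_mul]
    split_ifs <;> ring

theorem moebius_const_sub {n : ℕ} (hn : 0 < n) (f : (Fin n → ℤ) → ℤ) (a : ℤ) (d : Fin n → ℤ) :
    moebius (fun e => f e - a) d = moebius f d := by
  have : ∑ I : Finset (Fin n), (-1) ^ #I * a = 0 :=
    sum_neg_one_pow_card_mul_eq_zero ⟨0, hn⟩ _ fun _ _ => rfl
  simp only [moebius, mul_sub, sum_sub_distrib, this, sub_zero]

theorem weightComplete_eq_sum {n : ℕ} (hn : 0 < n) (d : Fin n → ℤ) :
    weightComplete n d = ∑ c ∈ Ico (0 : ℤ) n, ∑ I : Finset (Fin n),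
      (-1) ^ #I * max 0 (slack d c - #{i ∈ I | (n : ℤ) ∣ d i + c}) := by
  have : rank (⊤ : SimpleGraph (Fin n)) = fun d => slackSum d - 1 := funext (rank_top_eq hn)
  rw [weightComplete, this, moebius_const_sub hn, moebius, sum_comm]
  simp only [slackSum, slack_sub_eSum, mul_sum]

/-- The weight vanishes unless all entries are congruent modulo `n`: otherwise each `c` has an
index `j` at which the removal of a chip does not change the slack at `c`. -/
theorem weightComplete_eq_zero {n : ℕ} (hn : 0 < n) (d : Fin n → ℤ)
    (h : ∀ c, ∃ j, ¬ (n : ℤ) ∣ d j + c) : weightComplete n d = 0 := by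
  rw [weightComplete_eq_sum hn]
  refine sum_eq_zero fun c _ => ?_
  obtain ⟨j, hj⟩ := h c
  refine sum_neg_one_pow_card_mul_eq_zero j _ fun I _ => ?_
  rw [filter_insert, if_neg hj]

/-- If all entries are divisible by `n = m + 2`, only the slack at `c = 0` contributes. -/
theorem weightComplete_of_dvd {m : ℕ} (d : Fin (m + 2) → ℤ)
    (h : ∀ j, ((m + 2 : ℕ) : ℤ) ∣ d j) :
    weightComplete (m + 2) d =
      ∑ k ∈ range (m + 1), if slack d 0 = k + 1 then (-1) ^ k * (m.choose k : ℤ) else 0 := by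
  rw [weightComplete_eq_sum (by omega), sum_eq_single_of_mem 0 (by simp; omega)]
  · have h1 : ∀ I : Finset (Fin (m + 2)), {i ∈ I | ((m + 2 : ℕ) : ℤ) ∣ d i + 0} = I := fun I => by
      rw [filter_eq_self]
      simpa using fun i _ => h i
    simp only [h1]
    rw [← powerset_univ,
      sum_powerset_apply_card (fun k : ℕ => (-1 : ℤ) ^ k * max 0 (slack d 0 - k)),
      card_univ, Fintype.card_fin]
    simpa only [nsmul_eq_mul] using sum_choose_mul_max m (slack d 0)
  · intro c hc hne
    refine sum_neg_one_pow_card_mul_eq_zero 0 _ fun I _ => ?_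
    rw [filter_insert, if_neg]
    intro hdvd
    rw [dvd_add_right (h 0)] at hdvd
    rw [mem_Ico] at hc
    exact hne (Int.eq_zero_of_dvd_of_nonneg_of_lt hc.1 hc.2 hdvd)

/-! ### Coordinates on the classes -/

-- Below `n = m + 2`, so that the index type `Fin (n - 2)` of `b` is `Fin m` by definition.

theorem coord_castSucc_castSucc {m : ℕ} (b : Fin m → ℤ) (i : ℤ) (j : Fin m) :
    coord (n := m + 2) b i j.castSucc.castSucc = b j := by
  simp [coord]

theorem coord_castSucc_last {m : ℕ} (b : Fin m → ℤ) (i : ℤ) :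
    coord (n := m + 2) b i (Fin.last m).castSucc = 0 := by
  simp [coord]

theorem coord_last {m : ℕ} (b : Fin m → ℤ) (i : ℤ) :
    coord (n := m + 2) b i (Fin.last (m + 1)) = i - ∑ j, b j := by
  simp [coord]
  rfl

theorem deg_coord {m : ℕ} (b : Fin m → ℤ) (i : ℤ) : deg (coord (n := m + 2) b i) = i := by
  simp [deg, Fin.sum_univ_castSucc, coord_castSucc_castSucc, coord_castSucc_last, coord_last]

theorem existsUnique_equivalent_coord {m : ℕ} (d : Fin (m + 2) → ℤ) :
    ∃! p : (Fin m → ℤ) × ℤ, p.1 ∈ coordSet (m + 2) ∧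
      Equivalent (⊤ : SimpleGraph (Fin (m + 2))) d (coord p.1 p.2) := by
  have hn' : (0 : ℤ) < ((m + 2 : ℕ) : ℤ) := by positivity
  set z := d (Fin.last m).castSucc with hz
  refine ⟨(fun j => (d j.castSucc.castSucc - z) % ((m + 2 : ℕ) : ℤ), deg d), ⟨?_, ?_⟩, ?_⟩
  · intro j
    have h1 := Int.emod_nonneg (d j.castSucc.castSucc - z) hn'.ne'
    have h2 := Int.emod_lt_of_pos (d j.castSucc.castSucc - z) hn'
    exact ⟨h1, by simp only; omega⟩
  · refine equivalent_top_of_deg_eq (deg_coord _ _).symm (Fin.last (m + 1)) z ?_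
    intro i hi
    induction i using Fin.lastCases with
    | last => exact absurd rfl hi
    | cast i =>
      induction i using Fin.lastCases with
      | last => rw [coord_castSucc_last]; simp [hz]
      | cast i =>
        rw [coord_castSucc_castSucc, sub_right_comm]
        exact Int.dvd_self_sub_emod
  · rintro ⟨b, i⟩ ⟨hb, he⟩
    have hi : deg d = i := he.deg_eq.trans (deg_coord _ _)
    obtain ⟨s, hs⟩ := he.exists_dvd
    have h0 := hs (Fin.last m).castSucc
    rw [coord_castSucc_last] at h0
    refine Prod.ext (funext fun j => ?_) hi.symm
    have h1 := hs j.castSucc.castSucc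
    rw [coord_castSucc_castSucc] at h1
    have hbj : 0 ≤ b j ∧ b j ≤ ((m + 2 : ℕ) : ℤ) - 1 := hb j
    have h2 : ((m + 2 : ℕ) : ℤ) ∣ b j - (d j.castSucc.castSucc - z) := by
      rw [show b j - (d j.castSucc.castSucc - z) = z - 0 - s - (d j.castSucc.castSucc - b j - s) by
        ring]
      exact dvd_sub h0 h1
    have h3 := Int.emod_eq_emod_iff_emod_sub_eq_zero.2 (Int.emod_eq_zero_of_dvd h2)
    rw [Int.emod_eq_of_lt hbj.1 (by linarith)] at h3
    exact h3

theorem coord_zero_eq_single {m : ℕ} (i : ℤ) :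
    coord (n := m + 2) (0 : Fin m → ℤ) i = Pi.single (Fin.last (m + 1)) i := by
  funext k
  induction k using Fin.lastCases with
  | last => rw [coord_last]; simp
  | cast k =>
    rw [Pi.single_eq_of_ne (Fin.castSucc_ne_last k)]
    induction k using Fin.lastCases with
    | last => exact coord_castSucc_last _ _
    | cast k => exact coord_castSucc_castSucc _ _ _

theorem weightComplete_coord_zero_mul {m : ℕ} (q : ℤ) :
    weightComplete (m + 2) (coord (0 : Fin m → ℤ) (((m + 2 : ℕ) : ℤ) * q)) =
      ∑ k ∈ range (m + 1), if q = k then (-1) ^ k * (m.choose k : ℤ) else 0 := by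
  have hn' : ((m + 2 : ℕ) : ℤ) ≠ 0 := by positivity
  have hF : slack (Pi.single (Fin.last (m + 1)) (((m + 2 : ℕ) : ℤ) * q)) 0 = q + 1 := by
    unfold slack
    rw [sum_eq_single (Fin.last (m + 1)) (fun i _ hi => by simp [hi]) (by simp)]
    rw [Pi.single_eq_same, add_zero, Int.mul_ediv_cancel_left _ hn']
    ring
  rw [coord_zero_eq_single, weightComplete_of_dvd, hF]
  · simp only [add_left_inj]
  · intro j
    by_cases hj : j = Fin.last (m + 1)
    · subst hj; simp
    · simp [hj]

/-- The weight of `⟨b, i⟩` can be nonzero only if all entries are congruent modulo `n`, hence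
divisible by `n` because one of them is `0`. -/
theorem weightComplete_coord_eq_zero {m : ℕ} {b : Fin m → ℤ} (hb : b ∈ coordSet (m + 2)) (i : ℤ)
    (h : ¬ (b = 0 ∧ ((m + 2 : ℕ) : ℤ) ∣ i)) : weightComplete (m + 2) (coord b i) = 0 := by
  refine weightComplete_eq_zero (by omega) _ fun c => ?_
  by_contra! hc
  have h0 := hc (Fin.last m).castSucc
  rw [coord_castSucc_last, zero_add] at h0
  have hb0 : b = 0 := by
    funext j
    have h1 := hc j.castSucc.castSucc
    rw [coord_castSucc_castSucc, dvd_add_left h0] at h1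
    have hbj : 0 ≤ b j ∧ b j ≤ ((m + 2 : ℕ) : ℤ) - 1 := hb j
    exact Int.eq_zero_of_dvd_of_nonneg_of_lt hbj.1 (by linarith) h1
  refine h ⟨hb0, ?_⟩
  have h1 := hc (Fin.last (m + 1))
  rw [coord_last, dvd_add_left h0, hb0] at h1
  simpa using h1

end BakerNorine

theorem mainTheorem1 (n : ℕ) (hn : 2 ≤ n) :
    (∀ d d' : Fin n → ℤ, BakerNorine.Equivalent (⊤ : SimpleGraph (Fin n)) d d' →
      BakerNorine.weightComplete n d = BakerNorine.weightComplete n d') ∧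
    (∀ d : Fin n → ℤ, ∃! p : (Fin (n - 2) → ℤ) × ℤ, p.1 ∈ BakerNorine.coordSet n ∧
      BakerNorine.Equivalent (⊤ : SimpleGraph (Fin n)) d (BakerNorine.coord p.1 p.2)) ∧
    (∀ l : ℕ, l ≤ n - 2 →
      BakerNorine.weightComplete n (BakerNorine.coord 0 ((n : ℤ) * (l : ℤ))) =
        (-1) ^ l * ((n - 2).choose l : ℤ)) ∧
    (∀ b ∈ BakerNorine.coordSet n, ∀ i : ℤ,
      ¬ (b = 0 ∧ ∃ l : ℕ, l ≤ n - 2 ∧ i = (n : ℤ) * (l : ℤ)) →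
      BakerNorine.weightComplete n (BakerNorine.coord b i) = 0) := by
  obtain ⟨m, rfl⟩ : ∃ m, n = m + 2 := ⟨n - 2, by omega⟩
  refine ⟨fun d d' h => BakerNorine.weightComplete_eq_of_equivalent h,
    fun d => BakerNorine.existsUnique_equivalent_coord d, fun l hl => ?_, fun b hb i h => ?_⟩
  · refine (BakerNorine.weightComplete_coord_zero_mul (m := m) (l : ℤ)).trans ?_
    rw [Finset.sum_eq_single_of_mem l (Finset.mem_range.2 (by omega))
      (fun k _ hk => if_neg (by exact_mod_cast hk.symm)), if_pos rfl]
    rfl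
  · by_cases h' : b = 0 ∧ ((m + 2 : ℕ) : ℤ) ∣ i
    · obtain ⟨rfl, q, rfl⟩ := h'
      refine (BakerNorine.weightComplete_coord_zero_mul (m := m) q).trans ?_
      refine Finset.sum_eq_zero fun k hk => if_neg ?_
      rintro rfl
      have := Finset.mem_range.1 hk
      exact h ⟨rfl, k, by omega, rfl⟩
    · exact BakerNorine.weightComplete_coord_eq_zero hb i h'
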